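/- Let $\mathbb{T}$ be the unit circle in $\mathbb{C}$ and $\lambda$ its Haar probability measure. For a finite signed Borel measure $\mu$ on $\mathbb{T}$ let $c_\nu(\mu)=\int_{\mathbb{T}}\zeta^{-\nu}\,d\mu(\zeta)$, $\nu\in\mathbb{Z}$, be its Fourier coefficients. For an integer $N\ge 1$, call $\mu$ $N$-invariant if its image under the map $\zeta\mapsto\zeta^N$ is $\mu$ itself. Call $\mu$ special if $\mu=\alpha\lambda+\sigma$ for some $\alpha\in\mathbb{R}$ and some finite positive Borel measure $\sigma$ on $\mathbb{T}$ that is singular with respect to $\lambda$. Fix $N\ge 2$ and let $(c_\nu)_{\nu\in\mathbb{Z}}$ be a bounded sequence of complex numbers. Then there is an $N$-invariant special measure $\mu$ with $c_\nu(\mu)=c_\nu$ for all $\nu\in\mathbb{Z}$ if and only if the following three conditions hold: (i) $c_{-\nu}=\overline{c_\nu}$ for all $\nu\in\mathbb{Z}$; (ii) $c_{\nu N}=c_\nu$ for all $\nu\in\mathbb{Z}$; (iii) $\sum_{n=0}^\infty|b_n|^2<\infty$, where $(b_n)$ is defined by $$\sum_{n=0}^\infty b_nz^n=\exp\Bigl(-c_0-2\sum_{\nu=1}^\infty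 c_\nu z^\nu\Bigr)\qquad(|z|<1).$$ Such a measure $\mu$ is uniquely determined by $(c_\nu)$. Moreover, the equivalence remains true if (iii) is replaced by the following condition, which is implied by (iii): (iii') for some real $\varepsilon>0$ one has $\sum_{n=0}^\infty|b_n(\varepsilon)|^2<\infty$, where $(b_n(\varepsilon))$ is defined by $$\sum_{n=0}^\infty b_n(\varepsilon)z^n=\exp\Bigl(-\varepsilon\sum_{\nu=1}^\infty c_\nu z^\nu\Bigr)\qquad(|z|<1).$$ -/

import Mathlib

open MeasureTheory

noncomputable section

namespace CircleMeasure

/-- The Borel σ-algebra on the unit circle. -/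
instance instMeasurableSpaceCircle : MeasurableSpace Circle := borel Circle

instance instBorelSpaceCircle : BorelSpace Circle := ⟨rfl⟩

instance instFactTwoPiPos : Fact (0 < 2 * Real.pi) := ⟨Real.two_pi_pos⟩

/-- The Haar probability measure `λ` on the unit circle: the image of the normalized Haar measure
`(2π)⁻¹ dθ` of `ℝ / 2πℤ` under `θ ↦ exp (iθ)`. -/
def haar : Measure Circle :=
  Measure.map (AddCircle.toCircle (T := 2 * Real.pi)) AddCircle.haarAddCircle

instance instIsProbabilityMeasureHaar : IsProbabilityMeasure haar :=
  Measure.isProbabilityMeasure_map AddCircle.continuous_toCircle.aemeasurable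

/-- The Fourier coefficient `∫ ζ ^ (-ν) dμ(ζ)` of a finite signed measure on the circle. -/
def fourierCoefficient (μ : SignedMeasure Circle) (ν : ℤ) : ℂ :=
  ∫ᵛ ζ, (ζ : ℂ) ^ (-ν) ∂<•μ

/-- `μ` is invariant under `ζ ↦ ζ ^ N`, that is, equal to its image under this map. -/
def IsPowInvariant (N : ℕ) (μ : SignedMeasure Circle) : Prop :=
  μ.map (fun ζ : Circle => ζ ^ N) = μ

/-- `μ = α λ + σ` with `α` real and `σ` a finite positive measure that is singular with respect
to `λ`. -/
def IsSpecial (μ : SignedMeasure Circle) : Prop :=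
  ∃ (α : ℝ) (σ : Measure Circle) (_ : IsFiniteMeasure σ),
    σ ⟂ₘ haar ∧ μ = α • haar.toSignedMeasure + σ.toSignedMeasure

/-- `f` has a power series expansion `∑ b_n z ^ n` on the open unit disc, and its (uniquely
determined) coefficients satisfy `∑ |b_n| ^ 2 < ∞`. -/
def HasSquareSummableCoeffs (f : ℂ → ℂ) : Prop :=
  ∃ b : ℕ → ℂ, (∀ z : ℂ, ‖z‖ < 1 → HasSum (fun n : ℕ => b n * z ^ n) (f z)) ∧
    Summable fun n : ℕ => ‖b n‖ ^ 2

/-- The power series `∑_{ν ≥ 1} c_ν z ^ ν`. -/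
def positivePart (c : ℤ → ℂ) (z : ℂ) : ℂ :=
  ∑' n : ℕ, c (n + 1) * z ^ (n + 1)

end CircleMeasure

end

open MeasureTheory

noncomputable section

namespace CircleMeasure

open Filter Topology BoundedContinuousFunction ComplexConjugate

/-! ### Characters of the circle and Haar measure -/

/-! Write f(z) = ∑_{ν ≥ 1} c_ν z^ν. If μ = αλ + σ has coefficients c_ν, then c_0 + 2f is α plus the
Herglotz transform of σ ≥ 0. Its real part is at least α, so exp(-c_0 - 2f) is bounded by e^{-α},
hence lies in H². This gives (iii); (iii') with ε = 2 differs from it only by a constant factor.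

Conversely, assume (iii') and put u_r(ζ) = -ε Re f(rζ). By Parseval, ∫ e^{2u_r} dλ is bounded
uniformly in r < 1. Since u⁺ ≤ e^u, the positive parts are bounded in L². The mean of u_r is 0, so
the negative parts are bounded in L¹. Weak limits give u_r → p - q with p ≪ λ
(`exists_weak_limit_of_integral_exp_le`), and p - q has coefficients -(ε/2)c_ν for ν ≠ 0.

By (i) and (ii), p - q is N-invariant. The power map preserves singularity and absolute continuity
with respect to λ, so the singular part s of q and the absolutely continuous part of p - q are
separately invariant. The coefficients of the latter are constant along n N^k, while
Riemann–Lebesgue sends them to 0 when n ≠ 0. Hence p - q is a multiple of λ minus s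
(`integral_zpow_singularPart_of_invariant`), and μ is (2/ε)s plus a multiple of λ.

Uniqueness holds because trigonometric polynomials determine finite measures. -/

lemma continuous_coe_zpow (n : ℤ) : Continuous fun ζ : Circle => (ζ : ℂ) ^ n := by
  exact Continuous.zpow₀ (by fun_prop) n fun ζ => .inl ζ.coe_ne_zero

@[simp]
lemma norm_coe_zpow (n : ℤ) (ζ : Circle) : ‖(ζ : ℂ) ^ n‖ = 1 := by
  rw [norm_zpow, Circle.norm_coe, one_zpow]

lemma conj_coe_zpow (n : ℤ) (ζ : Circle) : conj ((ζ : ℂ) ^ n) = (ζ : ℂ) ^ (-n) := by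
  rw [map_zpow₀, ← Circle.coe_inv_eq_conj, Circle.coe_inv, inv_zpow, zpow_neg]

lemma integrable_of_continuous {E : Type*} [NormedAddCommGroup E] [SecondCountableTopology E]
    (ρ : Measure Circle) [IsFiniteMeasure ρ]
    {f : Circle → E} (hf : Continuous f) : Integrable f ρ := by
  obtain ⟨C, hC⟩ := isCompact_univ.exists_bound_of_continuousOn hf.continuousOn
  exact .of_bound hf.aestronglyMeasurable C (.of_forall fun x => hC x trivial)

/-- The character `ζ ↦ ζ ^ n` as a bounded continuous function. -/
def character (n : ℤ) : Circle →ᵇ ℂ :=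
  BoundedContinuousFunction.mkOfCompact ⟨fun ζ => (ζ : ℂ) ^ n, continuous_coe_zpow n⟩

@[simp]
lemma character_apply (n : ℤ) (ζ : Circle) : character n ζ = (ζ : ℂ) ^ n := rfl

lemma character_mul (m n : ℤ) : character m * character n = character (m + n) := by
  ext ζ
  simp [zpow_add₀]

lemma star_character (n : ℤ) : star (character n) = character (-n) := by
  ext ζ
  simpa using conj_coe_zpow n ζ

/-- The star-algebra of trigonometric polynomials on the circle. -/
def trigPolynomials : StarSubalgebra ℂ (Circle →ᵇ ℂ) where
  carrier := Submodule.span ℂ (Set.range character)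
  mul_mem' {f g} hf hg := by
    have h := Submodule.mul_mem_mul hf hg
    rw [Submodule.span_mul_span] at h
    refine Submodule.span_mono ?_ h
    rintro _ ⟨_, ⟨m, rfl⟩, _, ⟨n, rfl⟩, rfl⟩
    exact ⟨m + n, (character_mul m n).symm⟩
  add_mem' hf hg := Submodule.add_mem _ hf hg
  algebraMap_mem' r := by
    have h : algebraMap ℂ (Circle →ᵇ ℂ) r = r • character 0 := by
      ext ζ
      simp [BoundedContinuousFunction.algebraMap_apply]
    rw [h]
    exact Submodule.smul_mem _ _ (Submodule.subset_span ⟨0, rfl⟩)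
  star_mem' {f} hf := by
    induction hf using Submodule.span_induction with
    | mem x hx =>
      obtain ⟨n, rfl⟩ := hx
      exact Submodule.subset_span ⟨-n, (star_character n).symm⟩
    | zero => simp
    | add x y _ _ hx hy => simpa using Submodule.add_mem _ hx hy
    | smul a x _ hx => simpa using Submodule.smul_mem _ (star a) hx

/-- A finite measure on the circle is determined by its Fourier coefficients. -/
lemma measure_ext_of_integral_zpow {ρ₁ ρ₂ : Measure Circle} [IsFiniteMeasure ρ₁]
    [IsFiniteMeasure ρ₂]
    (h : ∀ n : ℤ, ∫ ζ : Circle, (ζ : ℂ) ^ n ∂ρ₁ = ∫ ζ : Circle, (ζ : ℂ) ^ n ∂ρ₂) : ρ₁ = ρ₂ := by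
  refine ext_of_forall_mem_subalgebra_integral_eq_of_polish (𝕜 := ℂ) (A := trigPolynomials) ?_ ?_
  · intro x y hxy
    -- The character of index 1 is the inclusion into ℂ and already separates points.
    refine ⟨_, ⟨_, ⟨character 1, Submodule.subset_span ⟨1, rfl⟩, rfl⟩, rfl⟩, ?_⟩
    simpa [Circle.coe_inj] using hxy
  · intro g hg
    induction (show g ∈ Submodule.span ℂ (Set.range character) from hg)
      using Submodule.span_induction with
    | mem x hx =>
      obtain ⟨n, rfl⟩ := hx
      exact h n
    | zero => simp
    | add x y hx' hy' hx hy =>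
      simp only [BoundedContinuousFunction.coe_add, Pi.add_apply]
      rw [integral_add (x.integrable _) (y.integrable _),
        integral_add (x.integrable _) (y.integrable _), hx hx', hy hy']
    | smul a x hx' hx =>
      simp only [BoundedContinuousFunction.coe_smul]
      rw [integral_smul, integral_smul, hx hx']

lemma integral_haar {E : Type*} [NormedAddCommGroup E] [NormedSpace ℝ E] {f : Circle → E}
    (hf : AEStronglyMeasurable f haar) :
    ∫ ζ, f ζ ∂haar =
      ∫ t, f (AddCircle.toCircle (T := 2 * Real.pi) t) ∂AddCircle.haarAddCircle :=
  integral_map AddCircle.continuous_toCircle.aemeasurable hf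

lemma integral_zpow_haar (n : ℤ) :
    ∫ ζ : Circle, (ζ : ℂ) ^ n ∂haar = if n = 0 then 1 else 0 := by
  rw [integral_haar (continuous_coe_zpow n).aestronglyMeasurable]
  -- The zeroth Fourier coefficient of a monomial is its integral.
  have h := congrFun (fourierCoeff_fourier (T := 2 * Real.pi) n) 0
  simp only [fourierCoeff, neg_zero, fourier_zero, one_smul, Pi.single_apply] at h
  simp only [fourier_apply, AddCircle.toCircle_zsmul, Circle.coe_zpow, eq_comm (a := (0 : ℤ))] at h
  exact h

/-! ### The power map, and Riemann–Lebesgue -/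

lemma integral_zpow_map_pow (ρ : Measure Circle) (N : ℕ) (n : ℤ) :
    ∫ ζ : Circle, (ζ : ℂ) ^ n ∂(ρ.map fun ζ => ζ ^ N) = ∫ ζ : Circle, (ζ : ℂ) ^ (n * N) ∂ρ := by
  rw [integral_map (by fun_prop) (continuous_coe_zpow n).aestronglyMeasurable]
  refine integral_congr_ae (.of_forall fun ζ => ?_)
  simp only
  rw [Circle.coe_pow, mul_comm n, zpow_mul, zpow_natCast]

lemma haar_map_pow {N : ℕ} (hN : N ≠ 0) : haar.map (fun ζ => ζ ^ N) = haar := by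
  have : IsFiniteMeasure (haar.map fun ζ : Circle => ζ ^ N) := Measure.isFiniteMeasure_map _ _
  refine measure_ext_of_integral_zpow fun n => ?_
  rw [integral_zpow_map_pow, integral_zpow_haar, integral_zpow_haar]
  simp [hN]

lemma haar_map_mul_left (w : Circle) : haar.map (fun ζ => w * ζ) = haar := by
  have : IsFiniteMeasure (haar.map fun ζ : Circle => w * ζ) := Measure.isFiniteMeasure_map _ _
  refine measure_ext_of_integral_zpow fun n => ?_
  rw [integral_map (by fun_prop) (continuous_coe_zpow n).aestronglyMeasurable]
  simp only [Circle.coe_mul, mul_zpow]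
  rw [integral_const_mul, integral_zpow_haar]
  split_ifs with h
  · simp [h]
  · simp

lemma surjective_pow {N : ℕ} (hN : N ≠ 0) : Function.Surjective fun ζ : Circle => ζ ^ N := by
  intro z
  obtain ⟨t, rfl⟩ := Circle.exp_surjective z
  refine ⟨Circle.exp (t / N), ?_⟩
  simp only [← Circle.exp_nsmul, nsmul_eq_mul]
  congr 1
  field_simp

/-- The image of a singular measure under `ζ ↦ ζ ^ N` is singular. -/
lemma mutuallySingular_map_pow {N : ℕ} (hN : N ≠ 0) {s : Measure Circle} (hs : s ⟂ₘ haar) :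
    s.map (fun ζ => ζ ^ N) ⟂ₘ haar := by
  obtain ⟨A, hA, hsA, hlA⟩ := hs
  have hT : Measurable fun ζ : Circle => ζ ^ N := by fun_prop
  -- the saturation of the null set carrying `s`
  have hfin : {w : Circle | w ^ N = 1}.Finite := by
    have h : ((Polynomial.nthRootsFinset N (1 : ℂ) : Finset ℂ) : Set ℂ).Finite :=
      Finset.finite_toSet _
    refine (h.preimage (f := fun w : Circle => (w : ℂ)) Circle.coe_injective.injOn).subset ?_
    intro w hw
    rw [Set.mem_preimage, Finset.mem_coe, Polynomial.mem_nthRootsFinset (Nat.pos_of_ne_zero hN),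
      ← Circle.coe_pow, hw, Circle.coe_one]
  set B : Set Circle := ⋃ w ∈ {w : Circle | w ^ N = 1}, (fun ζ => w * ζ) ⁻¹' Aᶜ with hB
  have hBmeas : MeasurableSet B :=
    hfin.measurableSet_biUnion fun w _ => hA.compl.preimage (by fun_prop)
  have hBnull : haar B = 0 := by
    refine (measure_biUnion_null_iff hfin.countable).2 fun w _ => ?_
    rw [← Measure.map_apply (by fun_prop) hA.compl, haar_map_mul_left, hlA]
  -- B is stable under multiplication by N-th roots of unity, so it is a union of fibres of the
  -- power map.
  have hsat : (fun ζ : Circle => ζ ^ N) ⁻¹' ((fun ζ : Circle => ζ ^ N) '' B) = B := by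
    refine Set.Subset.antisymm ?_ (Set.subset_preimage_image _ _)
    rintro ζ ⟨η, hη, hηζ⟩
    simp only [hB, Set.mem_iUnion, Set.mem_preimage, Set.mem_ofPred_eq] at hη ⊢
    obtain ⟨w, hw, hwη⟩ := hη
    refine ⟨w * η * ζ⁻¹, ?_, by simpa using hwη⟩
    simp only at hηζ
    rw [mul_pow, mul_pow, hw, hηζ, inv_pow, one_mul, mul_inv_cancel]
  -- A continuous image of a Borel set need not be Borel; this one is, because the map is surjective
  -- and the preimage of the image is the Borel set B.
  have himg : MeasurableSet ((fun ζ : Circle => ζ ^ N) '' B) := by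
    rw [← hT.measurableSet_preimage_iff_of_surjective (surjective_pow hN), hsat]
    exact hBmeas
  refine ⟨((fun ζ : Circle => ζ ^ N) '' B)ᶜ, himg.compl, ?_, ?_⟩
  · rw [Measure.map_apply hT himg.compl, Set.preimage_compl, hsat]
    refine measure_mono_null ?_ hsA
    rw [Set.compl_subset_comm]
    intro ζ hζ
    simp only [hB, Set.mem_iUnion]
    exact ⟨1, by simp, by simpa using hζ⟩
  · rw [compl_compl, ← haar_map_pow hN, Measure.map_apply hT himg, hsat, hBnull]

/-- The Riemann–Lebesgue lemma for absolutely continuous measures. -/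
lemma tendsto_integral_zpow_of_absolutelyContinuous {ρ : Measure Circle} [IsFiniteMeasure ρ]
    (hρ : ρ ≪ haar) {n : ℕ → ℤ} (hn : Tendsto n atTop (cocompact ℤ)) :
    Tendsto (fun k => ∫ ζ : Circle, (ζ : ℂ) ^ n k ∂ρ) atTop (𝓝 0) := by
  set g : Circle → ℝ := fun ζ => (ρ.rnDeriv haar ζ).toReal with hg
  have hgm : Measurable g := (Measure.measurable_rnDeriv ρ haar).ennreal_toReal
  set f : ℝ → ℂ := (Set.Ioc 0 (0 + 2 * Real.pi)).indicator fun t =>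
    (g (AddCircle.toCircle (t : AddCircle (2 * Real.pi))) : ℂ) with hf
  -- `Real.fourierChar` is t ↦ e^{2πit}, so the frequency -m/(2π) produces e^{imv}; the coefficient
  -- becomes a Fourier transform on ℝ of one period of the density.
  have key (m : ℤ) : ∫ ζ : Circle, (ζ : ℂ) ^ m ∂ρ =
      (2 * Real.pi)⁻¹ • ∫ v : ℝ, Real.fourierChar (-(v * (-(m : ℝ) / (2 * Real.pi)))) • f v := by
    rw [← integral_rnDeriv_smul hρ, integral_haar, AddCircle.integral_haarAddCircle,
      ← AddCircle.integral_preimage _ 0, ← integral_indicator measurableSet_Ioc]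
    · congr 2
      ext v
      by_cases hv : v ∈ Set.Ioc 0 (0 + 2 * Real.pi)
      · simp only [hf, Set.indicator_of_mem hv]
        rw [AddCircle.toCircle_apply_mk, ← Circle.coe_zpow, ← Circle.exp_zsmul,
          Circle.smul_def, Real.fourierChar_apply', Complex.real_smul, smul_eq_mul, mul_comm]
        congr 3
        rw [zsmul_eq_mul]
        field_simp
      · simp only [hf, Set.indicator_of_notMem hv, smul_zero]
    · exact ((hgm.stronglyMeasurable).smul
        (continuous_coe_zpow m).stronglyMeasurable).aestronglyMeasurable
  simp_rw [key]
  suffices h : Tendsto (fun k => ∫ v : ℝ,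
      Real.fourierChar (-(v * (-(n k : ℝ) / (2 * Real.pi)))) • f v) atTop (𝓝 0) by
    simpa using h.const_smul (2 * Real.pi)⁻¹
  refine (Real.tendsto_integral_exp_smul_cocompact f).comp ?_
  have h1 : Tendsto (fun k => ((n k : ℤ) : ℝ)) atTop (cocompact ℝ) :=
    Int.isClosedEmbedding_coe_real.tendsto_cocompact.comp hn
  have hpi : (-(2 * Real.pi)⁻¹ : ℝ) ≠ 0 := by
    have := Real.pi_pos
    simp [this.ne']
  refine ((Homeomorph.mulRight₀ _ hpi).isClosedEmbedding.tendsto_cocompact.comp h1).congr ?_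
  intro k
  simp [div_eq_mul_inv]

/-! ### Fourier coefficients of signed measures -/

lemma signedMeasure_integrable_of_continuous (μ : SignedMeasure Circle) {f : Circle → ℂ}
    (hf : Continuous f) : μ.Integrable f := by
  have : IsFiniteMeasure μ.variation := by
    rw [← SignedMeasure.totalVariation_eq_variation]
    infer_instance
  exact integrable_of_continuous _ hf

lemma fourierCoefficient_toSignedMeasure (ρ : Measure Circle) [IsFiniteMeasure ρ] (ν : ℤ) :
    fourierCoefficient ρ.toSignedMeasure ν = ∫ ζ : Circle, (ζ : ℂ) ^ (-ν) ∂ρ :=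
  VectorMeasure.integral_toSignedMeasure

lemma fourierCoefficient_add (μ₁ μ₂ : SignedMeasure Circle) (ν : ℤ) :
    fourierCoefficient (μ₁ + μ₂) ν = fourierCoefficient μ₁ ν + fourierCoefficient μ₂ ν :=
  VectorMeasure.integral_add_vectorMeasure
    (signedMeasure_integrable_of_continuous _ (continuous_coe_zpow _))
    (signedMeasure_integrable_of_continuous _ (continuous_coe_zpow _))

lemma fourierCoefficient_sub (μ₁ μ₂ : SignedMeasure Circle) (ν : ℤ) :
    fourierCoefficient (μ₁ - μ₂) ν = fourierCoefficient μ₁ ν - fourierCoefficient μ₂ ν :=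
  VectorMeasure.integral_sub_vectorMeasure
    (signedMeasure_integrable_of_continuous _ (continuous_coe_zpow _))
    (signedMeasure_integrable_of_continuous _ (continuous_coe_zpow _))

lemma fourierCoefficient_smul (a : ℝ) (μ : SignedMeasure Circle) (ν : ℤ) :
    fourierCoefficient (a • μ) ν = a * fourierCoefficient μ ν := by
  rw [← Complex.real_smul]
  exact VectorMeasure.integral_smul_vectorMeasure _ a

lemma fourierCoefficient_map_pow (N : ℕ) (μ : SignedMeasure Circle) (ν : ℤ) :
    fourierCoefficient (μ.map fun ζ => ζ ^ N) ν = fourierCoefficient μ (ν * N) := by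
  unfold fourierCoefficient
  rw [VectorMeasure.integral_map (by fun_prop) (continuous_coe_zpow _).aestronglyMeasurable
    (signedMeasure_integrable_of_continuous _ ((continuous_coe_zpow _).comp (by fun_prop)))]
  congr 1
  ext ζ
  rw [Circle.coe_pow, ← neg_mul, mul_comm _ (N : ℤ), zpow_mul, zpow_natCast]

/-- A finite signed measure on the circle is determined by its Fourier coefficients. -/
lemma signedMeasure_ext_of_fourierCoefficient {μ₁ μ₂ : SignedMeasure Circle}
    (h : ∀ ν, fourierCoefficient μ₁ ν = fourierCoefficient μ₂ ν) : μ₁ = μ₂ := by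
  obtain ⟨p₁, q₁, _, _, rfl⟩ : ∃ (p q : Measure Circle) (_ : IsFiniteMeasure p)
      (_ : IsFiniteMeasure q), μ₁ = p.toSignedMeasure - q.toSignedMeasure :=
    ⟨_, _, _, _, μ₁.toSignedMeasure_toJordanDecomposition.symm⟩
  obtain ⟨p₂, q₂, _, _, rfl⟩ : ∃ (p q : Measure Circle) (_ : IsFiniteMeasure p)
      (_ : IsFiniteMeasure q), μ₂ = p.toSignedMeasure - q.toSignedMeasure :=
    ⟨_, _, _, _, μ₂.toSignedMeasure_toJordanDecomposition.symm⟩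
  -- Moving the negative parts across reduces the claim to positive measures.
  have hsum : p₁ + q₂ = p₂ + q₁ := by
    refine measure_ext_of_integral_zpow fun n => ?_
    have hn := h (-n)
    simp only [fourierCoefficient_sub, fourierCoefficient_toSignedMeasure, neg_neg] at hn
    rw [integral_add_measure (integrable_of_continuous _ (continuous_coe_zpow n))
      (integrable_of_continuous _ (continuous_coe_zpow n)),
      integral_add_measure (integrable_of_continuous _ (continuous_coe_zpow n))
      (integrable_of_continuous _ (continuous_coe_zpow n))]
    linear_combination hn
  rw [← Measure.toSignedMeasure_eq_toSignedMeasure_iff, Measure.toSignedMeasure_add,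
    Measure.toSignedMeasure_add] at hsum
  rwa [sub_eq_sub_iff_add_eq_add]

/-- Taking the image under the power map replaces the coefficient of index ν by that of index νN,
and coefficients determine the measure. -/
lemma isPowInvariant_iff (N : ℕ) (μ : SignedMeasure Circle) :
    IsPowInvariant N μ ↔ ∀ ν : ℤ, fourierCoefficient μ (ν * N) = fourierCoefficient μ ν := by
  refine ⟨fun h ν => ?_, fun h => signedMeasure_ext_of_fourierCoefficient fun ν => ?_⟩
  · rw [← fourierCoefficient_map_pow, h]
  · rw [fourierCoefficient_map_pow, h]

lemma fourierCoefficient_special (a : ℝ) (σ : Measure Circle) [IsFiniteMeasure σ] (ν : ℤ) :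
    fourierCoefficient (a • haar.toSignedMeasure + σ.toSignedMeasure) ν =
      (if ν = 0 then (a : ℂ) else 0) + ∫ ζ : Circle, (ζ : ℂ) ^ (-ν) ∂σ := by
  rw [fourierCoefficient_add, fourierCoefficient_smul, fourierCoefficient_toSignedMeasure,
    fourierCoefficient_toSignedMeasure, integral_zpow_haar]
  simp

lemma integral_zpow_neg (ρ : Measure Circle) (n : ℤ) :
    ∫ ζ : Circle, (ζ : ℂ) ^ (-n) ∂ρ = conj (∫ ζ : Circle, (ζ : ℂ) ^ n ∂ρ) := by
  rw [← integral_conj]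
  simp_rw [conj_coe_zpow]

/-! ### Power series on circles -/

lemma continuous_tsum_mul_pow {a : ℕ → ℂ} (ha : Summable fun n => ‖a n‖) :
    Continuous fun ζ : Circle => ∑' n, a n * (ζ : ℂ) ^ n :=
  continuous_tsum (fun n => by fun_prop) ha fun n ζ => by
    rw [norm_mul, norm_pow, Circle.norm_coe, one_pow, mul_one]

/-- Fourier coefficients of an absolutely convergent power series on the circle. -/
lemma integral_tsum_mul_zpow {a : ℕ → ℂ} (ha : Summable fun n => ‖a n‖) (k : ℤ) :
    ∫ ζ : Circle, (∑' n, a n * (ζ : ℂ) ^ n) * (ζ : ℂ) ^ (-k) ∂haar =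
      if 0 ≤ k then a k.toNat else 0 := by
  have h := hasSum_integral_of_summable_integral_norm (μ := haar)
    (F := fun (n : ℕ) (ζ : Circle) => a n * (ζ : ℂ) ^ n * (ζ : ℂ) ^ (-k))
    (fun n => integrable_of_continuous _ ((by fun_prop : Continuous _).mul (continuous_coe_zpow _)))
    (by simpa [Circle.norm_coe] using ha)
  simp_rw [tsum_mul_right] at h
  rw [← h.tsum_eq]
  have hterm (n : ℕ) : ∫ ζ : Circle, a n * (ζ : ℂ) ^ n * (ζ : ℂ) ^ (-k) ∂haar =
      if (n : ℤ) = k then a n else 0 := by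
    have h1 (ζ : Circle) : a n * (ζ : ℂ) ^ n * (ζ : ℂ) ^ (-k) = a n * (ζ : ℂ) ^ (n - k : ℤ) := by
      rw [mul_assoc, ← zpow_natCast, ← zpow_add₀ ζ.coe_ne_zero, sub_eq_add_neg]
    simp_rw [h1]
    rw [integral_const_mul, integral_zpow_haar]
    simp [sub_eq_zero]
  simp_rw [hterm]
  split_ifs with hk
  · obtain ⟨m, rfl⟩ := Int.eq_ofNat_of_zero_le hk
    simp only [Int.ofNat_inj, Int.toNat_natCast]
    exact tsum_ite_eq m a
  · have : ∀ n : ℕ, (n : ℤ) ≠ k := by omega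
    simp [this]

lemma summable_norm_mul_pow {b : ℕ → ℂ} {F : ℂ → ℂ}
    (hb : ∀ z : ℂ, ‖z‖ < 1 → HasSum (fun n : ℕ => b n * z ^ n) (F z)) {r : ℝ} (hr0 : 0 ≤ r)
    (hr : r < 1) : Summable fun n => ‖b n * (r : ℂ) ^ n‖ :=
  (hb r (by simpa [abs_of_nonneg hr0] using hr)).summable.norm

lemma eq_tsum_on_circle {b : ℕ → ℂ} {F : ℂ → ℂ}
    (hb : ∀ z : ℂ, ‖z‖ < 1 → HasSum (fun n : ℕ => b n * z ^ n) (F z)) {r : ℝ} (hr0 : 0 ≤ r)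
    (hr : r < 1) (ζ : Circle) : F (r * ζ) = ∑' n, b n * (r : ℂ) ^ n * (ζ : ℂ) ^ n := by
  rw [← (hb (r * ζ) (by simpa [Circle.norm_coe, abs_of_nonneg hr0] using hr)).tsum_eq]
  simp_rw [mul_pow, mul_assoc]

/-- Parseval's identity for a power series on the circle of radius `r`. -/
lemma hasSum_sq_norm_coeff {b : ℕ → ℂ} {F : ℂ → ℂ}
    (hb : ∀ z : ℂ, ‖z‖ < 1 → HasSum (fun n : ℕ => b n * z ^ n) (F z)) {r : ℝ} (hr0 : 0 ≤ r)
    (hr : r < 1) :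
    HasSum (fun n => ‖b n‖ ^ 2 * (r ^ n) ^ 2) (∫ ζ : Circle, ‖F (r * ζ)‖ ^ 2 ∂haar) := by
  have ha := summable_norm_mul_pow hb hr0 hr
  have hF := eq_tsum_on_circle hb hr0 hr
  set a : ℕ → ℂ := fun n => b n * (r : ℂ) ^ n with ha_def
  have hcont : Continuous fun ζ : Circle => F (r * ζ) := by
    simp_rw [hF]
    exact continuous_tsum_mul_pow ha
  -- In conj F · F only the first factor is expanded, which avoids a double series: each term is
  -- conj(a_n) times the n-th Fourier coefficient of F on the circle.
  have h := hasSum_integral_of_summable_integral_norm (μ := haar)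
    (F := fun (n : ℕ) (ζ : Circle) => conj (a n) * (F (r * ζ) * (ζ : ℂ) ^ (-(n : ℤ))))
    (fun n => integrable_of_continuous _
      (continuous_const.mul (hcont.mul (continuous_coe_zpow _)))) (by
      simp only [norm_mul, RCLike.norm_conj, norm_coe_zpow, mul_one]
      simp_rw [integral_const_mul]
      exact ha.mul_right _)
  have hleft (n : ℕ) : ∫ ζ : Circle, conj (a n) * (F (r * ζ) * (ζ : ℂ) ^ (-(n : ℤ))) ∂haar =
      ((‖b n‖ ^ 2 * (r ^ n) ^ 2 : ℝ) : ℂ) := by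
    rw [integral_const_mul]
    simp_rw [hF]
    rw [integral_tsum_mul_zpow ha]
    simp only [Nat.cast_nonneg, if_true, Int.toNat_natCast]
    rw [Complex.conj_mul', ha_def]
    simp [mul_pow, abs_of_nonneg hr0]
  have hright (ζ : Circle) : ∑' n : ℕ, conj (a n) * (F (r * ζ) * (ζ : ℂ) ^ (-(n : ℤ))) =
      ((‖F (r * ζ)‖ ^ 2 : ℝ) : ℂ) := by
    have h1 : conj (F (r * ζ)) = ∑' n : ℕ, conj (a n) * (ζ : ℂ) ^ (-(n : ℤ)) := by
      rw [hF, Complex.conj_tsum]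
      refine tsum_congr fun n => ?_
      rw [map_mul, ← zpow_natCast (ζ : ℂ), conj_coe_zpow]
    have h2 : ((‖F (r * ζ)‖ ^ 2 : ℝ) : ℂ) = conj (F (r * ζ)) * F (r * ζ) := by
      rw [Complex.conj_mul', Complex.ofReal_pow]
    rw [h2, h1, ← tsum_mul_right]
    refine tsum_congr fun n => ?_
    ring
  simp_rw [hleft, hright] at h
  have hI : ∫ ζ : Circle, ((‖F (r * ζ)‖ ^ 2 : ℝ) : ℂ) ∂haar =
      ((∫ ζ : Circle, ‖F (r * ζ)‖ ^ 2 ∂haar : ℝ) : ℂ) := integral_ofReal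
  rw [hI] at h
  exact Complex.hasSum_ofReal.1 h

/-- A bounded holomorphic function on the unit disc has square summable Taylor coefficients. -/
lemma hasSquareSummableCoeffs_of_bounded {F : ℂ → ℂ} {M : ℝ}
    (hF : DifferentiableOn ℂ F (Metric.ball 0 1)) (hM : ∀ z : ℂ, ‖z‖ < 1 → ‖F z‖ ≤ M) :
    HasSquareSummableCoeffs F := by
  have hb : ∀ z : ℂ, ‖z‖ < 1 →
      HasSum (fun n : ℕ => ((n.factorial : ℂ)⁻¹ * iteratedDeriv n F 0) * z ^ n) (F z) := by
    intro z hz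
    have h := Complex.hasSum_taylorSeries_on_ball (r := 1) (by simpa using hF) (z := z)
      (by simpa using hz)
    refine h.congr_fun fun n => ?_
    simp [mul_comm, mul_left_comm]
  refine ⟨_, hb, ?_⟩
  set b : ℕ → ℂ := fun n => (n.factorial : ℂ)⁻¹ * iteratedDeriv n F 0
  refine summable_of_sum_range_le (c := M ^ 2) (fun n => by positivity) fun m => ?_
  have hr (r : ℝ) (hr0 : 0 ≤ r) (hr1 : r < 1) :
      ∑ n ∈ Finset.range m, ‖b n‖ ^ 2 * (r ^ n) ^ 2 ≤ M ^ 2 := by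
    refine (sum_le_hasSum _ (fun n _ => by positivity) (hasSum_sq_norm_coeff hb hr0 hr1)).trans ?_
    have h1 : ∀ ζ : Circle, ‖F (r * ζ)‖ ^ 2 ≤ M ^ 2 := fun ζ => by
      have := hM (r * ζ) (by simpa [Circle.norm_coe, abs_of_nonneg hr0] using hr1)
      gcongr
    have h2 := integral_mono_of_nonneg (μ := haar)
      (.of_forall fun ζ : Circle => by positivity) (integrable_const (M ^ 2)) (.of_forall h1)
    simpa using h2
  -- The bound on each partial sum is uniform in r, so it survives r → 1.
  have hlim : Tendsto (fun r : ℝ => ∑ n ∈ Finset.range m, ‖b n‖ ^ 2 * (r ^ n) ^ 2) (𝓝[<] 1)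
      (𝓝 (∑ n ∈ Finset.range m, ‖b n‖ ^ 2)) := by
    have hc : Continuous fun r : ℝ => ∑ n ∈ Finset.range m, ‖b n‖ ^ 2 * (r ^ n) ^ 2 := by fun_prop
    have := hc.tendsto 1
    simp only [one_pow, mul_one] at this
    exact this.mono_left nhdsWithin_le_nhds
  refine le_of_tendsto hlim ?_
  filter_upwards [Ioo_mem_nhdsLT (zero_lt_one' ℝ)] with r hr'
  exact hr r hr'.1.le hr'.2

lemma hasSum_positivePart {c : ℤ → ℂ} {C : ℝ} (hc : ∀ ν, ‖c ν‖ ≤ C) {z : ℂ} (hz : ‖z‖ < 1) :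
    HasSum (fun n : ℕ => c (n + 1) * z ^ (n + 1)) (positivePart c z) := by
  refine Summable.hasSum (.of_norm_bounded (g := fun n => C * ‖z‖ ^ (n + 1)) ?_ fun n => ?_)
  · exact (((summable_geometric_of_lt_one (norm_nonneg z) hz).comp_injective
      (add_left_injective 1))).mul_left C
  · rw [norm_mul, norm_pow]
    gcongr
    exact hc _

lemma differentiableOn_positivePart {c : ℤ → ℂ} {C : ℝ} (hc : ∀ ν, ‖c ν‖ ≤ C) :
    DifferentiableOn ℂ (positivePart c) (Metric.ball 0 1) := by
  intro z hz
  obtain ⟨r, hzr, hr⟩ := exists_between (mem_ball_zero_iff.1 hz)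
  have hr0 : 0 ≤ r := (norm_nonneg z).trans hzr.le
  have hd : DifferentiableOn ℂ (positivePart c) (Metric.ball 0 r) := by
    refine Complex.differentiableOn_tsum_of_summable_norm (u := fun n => C * r ^ (n + 1)) ?_
      (fun n => by fun_prop) Metric.isOpen_ball fun n w hw => ?_
    · exact (((summable_geometric_of_lt_one hr0 hr).comp_injective
        (add_left_injective 1))).mul_left C
    · rw [norm_mul, norm_pow]
      have := mem_ball_zero_iff.1 hw
      gcongr
      · exact (norm_nonneg _).trans (hc 0)
      · exact hc _
  exact (hd.differentiableAt (Metric.isOpen_ball.mem_nhds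
    (mem_ball_zero_iff.2 hzr))).differentiableWithinAt

/-! ### The Herglotz transform -/

/-- The sum is (1 + w)/(1 - w), with real part (1 - |w|²)/|1 - w|², the Poisson kernel. -/
lemma re_one_add_two_mul_tsum_nonneg {w : ℂ} (hw : ‖w‖ < 1) :
    0 ≤ (1 + 2 * ∑' n : ℕ, w ^ (n + 1)).re := by
  have hw1 : 1 - w ≠ 0 := by
    intro h
    rw [sub_eq_zero] at h
    simp [← h] at hw
  have h : (1 + 2 * ∑' n : ℕ, w ^ (n + 1)) = (1 + w) / (1 - w) := by
    simp_rw [pow_succ]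
    rw [tsum_mul_right, tsum_geometric_of_norm_lt_one hw]
    field_simp
    ring
  rw [h, Complex.div_re, ← add_div]
  refine div_nonneg ?_ (Complex.normSq_nonneg _)
  have h2 : ‖w‖ ^ 2 < 1 := by nlinarith [norm_nonneg w]
  rw [← Complex.normSq_eq_norm_sq, Complex.normSq_apply] at h2
  simp
  nlinarith

/-- The Herglotz transform of a positive measure has nonnegative real part. -/
lemma re_herglotz_nonneg (σ : Measure Circle) [IsFiniteMeasure σ] {z : ℂ} (hz : ‖z‖ < 1) :
    0 ≤ (∫ ζ : Circle, (ζ : ℂ) ^ (-(0 : ℤ)) ∂σ +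
      2 * positivePart (fun ν => ∫ ζ : Circle, (ζ : ℂ) ^ (-ν) ∂σ) z).re := by
  have hint (n : ℕ) : Integrable (fun ζ : Circle => (z * (ζ : ℂ) ^ (-1 : ℤ)) ^ (n + 1)) σ :=
    integrable_of_continuous _ ((continuous_const.mul (continuous_coe_zpow _)).pow _)
  have hsum : Summable fun n : ℕ => ‖z‖ ^ (n + 1) :=
    (summable_geometric_of_lt_one (norm_nonneg z) hz).comp_injective (add_left_injective 1)
  have hnorm (n : ℕ) (ζ : Circle) : ‖(z * (ζ : ℂ) ^ (-1 : ℤ)) ^ (n + 1)‖ = ‖z‖ ^ (n + 1) := by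
    rw [norm_pow, norm_mul, norm_coe_zpow, mul_one]
  have h := hasSum_integral_of_summable_integral_norm hint (by
    simp_rw [hnorm]
    simpa using hsum.mul_left _)
  have hcont : Continuous fun ζ : Circle => ∑' n : ℕ, (z * (ζ : ℂ) ^ (-1 : ℤ)) ^ (n + 1) :=
    continuous_tsum (fun n => (continuous_const.mul (continuous_coe_zpow _)).pow _) hsum
      fun n ζ => (hnorm n ζ).le
  have hpos : positivePart (fun ν => ∫ ζ : Circle, (ζ : ℂ) ^ (-ν) ∂σ) z =
      ∫ ζ : Circle, ∑' n : ℕ, (z * (ζ : ℂ) ^ (-1 : ℤ)) ^ (n + 1) ∂σ := by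
    rw [← h.tsum_eq, positivePart]
    refine tsum_congr fun n => ?_
    simp_rw [mul_pow]
    rw [integral_const_mul, mul_comm]
    congr! 2
    ext ζ
    rw [← zpow_natCast, ← zpow_mul]
    push_cast
    ring_nf
  have htot : (∫ ζ : Circle, (ζ : ℂ) ^ (-(0 : ℤ)) ∂σ +
      2 * positivePart (fun ν => ∫ ζ : Circle, (ζ : ℂ) ^ (-ν) ∂σ) z) =
      ∫ ζ : Circle, (1 + 2 * ∑' n : ℕ, (z * (ζ : ℂ) ^ (-1 : ℤ)) ^ (n + 1)) ∂σ := by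
    rw [hpos, integral_add (f := fun _ : Circle => (1 : ℂ))
      (g := fun ζ : Circle => 2 * ∑' n : ℕ, (z * (ζ : ℂ) ^ (-1 : ℤ)) ^ (n + 1))
      (integrable_const _) (integrable_of_continuous _ (continuous_const.mul hcont)),
      integral_const_mul]
    simp
  rw [htot]
  have hre := integral_re (𝕜 := ℂ) (μ := σ)
    (f := fun ζ : Circle => (1 + 2 * ∑' n : ℕ, (z * (ζ : ℂ) ^ (-1 : ℤ)) ^ (n + 1)))
    (integrable_of_continuous _ (continuous_const.add (continuous_const.mul hcont)))
  refine le_of_le_of_eq (integral_nonneg fun ζ => ?_) hre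
  refine re_one_add_two_mul_tsum_nonneg ?_
  rwa [norm_mul, norm_coe_zpow, mul_one]

/-! ### Weak limits of absolutely continuous measures -/

/-- Weak compactness: densities bounded in `L¹` converge weakly to a finite measure along any
ultrafilter. -/
lemma exists_weak_limit {v : ℕ → Circle → ℝ} (hv : ∀ k, Continuous (v k)) (hv0 : ∀ k ζ, 0 ≤ v k ζ)
    {M : ℝ} (hM : ∀ k, ∫ ζ, v k ζ ∂haar ≤ M) (U : Ultrafilter ℕ) :
    ∃ (p : Measure Circle) (_ : IsFiniteMeasure p), ∀ f : Circle → ℝ, Continuous f →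
      Tendsto (fun k => ∫ ζ, f ζ * v k ζ ∂haar) U (𝓝 (∫ ζ, f ζ ∂p)) := by
  have hmeas (k : ℕ) : Measurable fun ζ => (v k ζ).toNNReal := (hv k).measurable.real_toNNReal
  have hmass (k : ℕ) : (haar.withDensity fun ζ => ((v k ζ).toNNReal : ENNReal)) Set.univ =
      ENNReal.ofReal (∫ ζ, v k ζ ∂haar) := by
    rw [withDensity_apply _ MeasurableSet.univ, Measure.restrict_univ,
      ofReal_integral_eq_lintegral_ofReal (integrable_of_continuous _ (hv k))
        (.of_forall (hv0 k))]
    rfl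
  let m (k : ℕ) : FiniteMeasure Circle :=
    ⟨haar.withDensity fun ζ => ((v k ζ).toNNReal : ENNReal), ⟨by rw [hmass]; simp⟩⟩
  have hm (k : ℕ) (f : Circle → ℝ) :
      ∫ ζ, f ζ ∂(m k : Measure Circle) = ∫ ζ, f ζ * v k ζ ∂haar := by
    change ∫ ζ, f ζ ∂(haar.withDensity fun ζ => ((v k ζ).toNNReal : ENNReal)) = _
    rw [integral_withDensity_eq_integral_smul (hmeas k)]
    refine integral_congr_ae (.of_forall fun ζ => ?_)
    simp only [NNReal.smul_def, smul_eq_mul, Real.coe_toNNReal _ (hv0 k ζ), mul_comm]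
  have hmem (k : ℕ) : m k ∈ {μ : FiniteMeasure Circle | μ.mass ≤ M.toNNReal} := by
    change (((haar.withDensity fun ζ => ((v k ζ).toNNReal : ENNReal)) Set.univ).toNNReal) ≤ _
    rw [hmass]
    exact Real.toNNReal_mono (hM k)
  -- Measures of mass at most M form a weakly compact set; an ultrafilter converges there without
  -- passing to subsequences.
  obtain ⟨p, -, hp⟩ := isCompact_iff_ultrafilter_le_nhds'.1
    (isCompact_setOfPred_finiteMeasure_le_of_compactSpace Circle M.toNNReal) (U.map m)
    (Filter.mem_map.2 (Filter.univ_mem' hmem))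
  refine ⟨p, inferInstance, fun f hf => ?_⟩
  have hp' : Tendsto m U (𝓝 p) := hp
  have h := FiniteMeasure.tendsto_iff_forall_integral_tendsto.1 hp'
    (BoundedContinuousFunction.mkOfCompact ⟨f, hf⟩)
  simpa only [BoundedContinuousFunction.mkOfCompact_apply, ContinuousMap.coe_mk, hm] using h

/-- A weak limit of densities that are bounded in `L²` is absolutely continuous. -/
lemma absolutelyContinuous_of_weak_limit {v : ℕ → Circle → ℝ} (hv : ∀ k, Continuous (v k))
    {B : ℝ} (hB : ∀ k, ∫ ζ, v k ζ ^ 2 ∂haar ≤ B) (U : Ultrafilter ℕ)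
    {p : Measure Circle} [IsFiniteMeasure p]
    (hp : ∀ f : Circle → ℝ, Continuous f →
      Tendsto (fun k => ∫ ζ, f ζ * v k ζ ∂haar) U (𝓝 (∫ ζ, f ζ ∂p))) : p ≪ haar := by
  refine Measure.AbsolutelyContinuous.mk fun A _ hA => ?_
  have hB0 : 0 ≤ B := (integral_nonneg fun ζ => sq_nonneg _).trans (hB 0)
  -- the bound for open sets
  have hopen (V : Set Circle) (hV : IsOpen V) (t : ℝ) (ht : 0 < t) :
      p V ≤ ENNReal.ofReal (t * haar.real V + B / t) := by
    rw [hV.measure_eq_biSup_integral_continuous p]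
    refine iSup_le fun f => iSup_le fun hf => iSup_le fun hfV => iSup_le fun hf0 => iSup_le
      fun hf1 => ENNReal.ofReal_le_ofReal ?_
    refine le_of_tendsto (hp f hf) (.of_forall fun k => ?_)
    -- Weighted AM–GM: the free parameter t balances the size of V against the L² bound.
    have hle (ζ : Circle) : f ζ * v k ζ ≤ t * V.indicator 1 ζ + v k ζ ^ 2 / t := by
      by_cases hζ : ζ ∈ V
      · have h1 : f ζ * v k ζ ≤ t * f ζ ^ 2 + v k ζ ^ 2 / t := by
          rw [← sub_nonneg]
          have : t * f ζ ^ 2 + v k ζ ^ 2 / t - f ζ * v k ζ =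
              ((t * f ζ - v k ζ) ^ 2 + (t * f ζ) ^ 2 + v k ζ ^ 2) / (2 * t) := by
            field_simp
            ring
          rw [this]
          positivity
        have h2 : f ζ ^ 2 ≤ 1 := pow_le_one₀ (hf0 ζ) (hf1 ζ)
        simp only [Set.indicator_of_mem hζ, Pi.one_apply]
        nlinarith
      · have : f ζ = 0 := hfV hζ
        rw [this, Set.indicator_of_notMem hζ]
        simp only [zero_mul, mul_zero, zero_add]
        positivity
    have hint1 : Integrable (fun ζ => t * V.indicator (1 : Circle → ℝ) ζ) haar :=
      ((integrable_const (1 : ℝ)).indicator hV.measurableSet).const_mul t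
    have hint2 : Integrable (fun ζ => v k ζ ^ 2 / t) haar :=
      integrable_of_continuous _ (((hv k).pow 2).div_const t)
    calc ∫ ζ, f ζ * v k ζ ∂haar ≤ ∫ ζ, (t * V.indicator 1 ζ + v k ζ ^ 2 / t) ∂haar :=
          integral_mono (integrable_of_continuous _ (hf.mul (hv k))) (hint1.add hint2) hle
      _ = t * haar.real V + (∫ ζ, v k ζ ^ 2 ∂haar) / t := by
          rw [integral_add hint1 hint2, integral_const_mul, integral_indicator_one hV.measurableSet,
            integral_div]
      _ ≤ t * haar.real V + B / t := by
          gcongr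
          exact hB k
  refine le_antisymm (ENNReal.le_of_forall_pos_le_add fun ε hε _ => ?_) bot_le
  have hε' : (0 : ℝ) < ε := hε
  -- This makes B/t ≤ ε/2; V is then taken so small that tλ(V) ≤ ε/2. Using B + 1 keeps t positive
  -- when B = 0.
  set t : ℝ := 2 * (B + 1) / ε with ht_def
  have ht : 0 < t := by positivity
  obtain ⟨V, hAV, hV, hVlt⟩ := A.exists_isOpen_lt_of_lt (μ := haar)
    (ENNReal.ofReal (ε / (2 * t))) (by rw [hA]; simp only [ENNReal.ofReal_pos]; positivity)
  have hVr : haar.real V ≤ ε / (2 * t) := ENNReal.toReal_le_of_le_ofReal (by positivity) hVlt.le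
  calc p A ≤ p V := measure_mono hAV
    _ ≤ ENNReal.ofReal (t * haar.real V + B / t) := hopen V hV t ht
    _ ≤ ENNReal.ofReal (ε : ℝ) := by
        refine ENNReal.ofReal_le_ofReal ?_
        have h1 : t * haar.real V ≤ ε / 2 := by
          calc t * haar.real V ≤ t * (ε / (2 * t)) := by gcongr
            _ = ε / 2 := by field_simp
        have h2 : B / t ≤ ε / 2 := by
          rw [ht_def, div_le_iff₀ (by positivity)]
          field_simp
          linarith
        linarith
    _ = 0 + (ε : ENNReal) := by simp

lemma integral_ofReal_mul_complex {ρ : Measure Circle} [IsFiniteMeasure ρ] {f : Circle → ℂ}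
    (hf : Continuous f) {v : Circle → ℝ} (hv : Continuous v) :
    ∫ ζ, f ζ * (v ζ : ℂ) ∂ρ =
      ((∫ ζ, (f ζ).re * v ζ ∂ρ : ℝ) : ℂ) + ((∫ ζ, (f ζ).im * v ζ ∂ρ : ℝ) : ℂ) * Complex.I := by
  have hc : Continuous fun ζ => f ζ * (v ζ : ℂ) := by fun_prop
  have h := integral_re_add_im (𝕜 := ℂ) (integrable_of_continuous ρ hc)
  simpa using h.symm

/-- Continuous functions of mean zero whose exponentials are bounded in `L²` converge weakly along
an ultrafilter to a difference of finite measures of which the first is absolutely continuous. -/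
lemma exists_weak_limit_of_integral_exp_le {u : ℕ → Circle → ℝ} (hu : ∀ k, Continuous (u k))
    {B : ℝ} (hB : ∀ k, ∫ ζ, Real.exp (u k ζ) ^ 2 ∂haar ≤ B)
    (hu0 : ∀ k, ∫ ζ, u k ζ ∂haar = 0) (U : Ultrafilter ℕ) :
    ∃ (p q : Measure Circle) (_ : IsFiniteMeasure p) (_ : IsFiniteMeasure q), p ≪ haar ∧
      ∀ f : Circle → ℂ, Continuous f →
        Tendsto (fun k => ∫ ζ, f ζ * (u k ζ : ℂ) ∂haar) U (𝓝 (∫ ζ, f ζ ∂p - ∫ ζ, f ζ ∂q)) := by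
  have hpos (k : ℕ) : Continuous fun ζ => max (u k ζ) 0 := (hu k).max continuous_const
  have hneg (k : ℕ) : Continuous fun ζ => max (-u k ζ) 0 := (hu k).neg.max continuous_const
  have hsplit (x : ℝ) : x = max x 0 - max (-x) 0 := by
    rcases le_total x 0 with h | h
    · rw [max_eq_right h, max_eq_left (by linarith)]; ring
    · rw [max_eq_left h, max_eq_right (by linarith)]; ring
  have hle (x : ℝ) : max x 0 ≤ Real.exp x :=
    max_le (by linarith [Real.add_one_le_exp x]) (Real.exp_pos x).le
  have hexp (k : ℕ) : Continuous fun ζ => Real.exp (u k ζ) ^ 2 := by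
    have := hu k
    fun_prop
  have hsq (k : ℕ) : ∫ ζ, max (u k ζ) 0 ^ 2 ∂haar ≤ B := by
    refine le_trans (integral_mono (integrable_of_continuous _ ((hpos k).pow 2))
      (integrable_of_continuous _ (hexp k)) fun ζ => ?_) (hB k)
    exact pow_le_pow_left₀ (le_max_right _ _) (hle _) 2
  have hM (k : ℕ) : ∫ ζ, max (u k ζ) 0 ∂haar ≤ 1 + B := by
    have h1 : ∫ ζ, max (u k ζ) 0 ∂haar ≤ ∫ ζ, (1 + max (u k ζ) 0 ^ 2) ∂haar :=
      integral_mono (integrable_of_continuous _ (hpos k))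
        (integrable_of_continuous _ (continuous_const.add ((hpos k).pow 2)))
        fun ζ => by nlinarith [sq_nonneg (max (u k ζ) 0 - 1), le_max_right (u k ζ) 0]
    rw [integral_add (f := fun _ => (1 : ℝ)) (g := fun ζ => max (u k ζ) 0 ^ 2)
      (integrable_const _) (integrable_of_continuous _ ((hpos k).pow 2))] at h1
    simp only [integral_const, probReal_univ, one_smul] at h1
    linarith [hsq k]
  -- Mean zero forces the positive and negative parts to have equal mass.
  have hM' (k : ℕ) : ∫ ζ, max (-u k ζ) 0 ∂haar ≤ 1 + B := by
    have h1 : ∫ ζ, u k ζ ∂haar = ∫ ζ, max (u k ζ) 0 ∂haar - ∫ ζ, max (-u k ζ) 0 ∂haar := by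
      rw [← integral_sub (integrable_of_continuous _ (hpos k))
        (integrable_of_continuous _ (hneg k))]
      exact integral_congr_ae (.of_forall fun ζ => hsplit _)
    linarith [hu0 k, hM k]
  obtain ⟨p, _, hp⟩ := exists_weak_limit hpos (fun _ _ => le_max_right _ _) hM U
  obtain ⟨q, _, hq⟩ := exists_weak_limit hneg (fun _ _ => le_max_right _ _) hM' U
  have hac : p ≪ haar := absolutelyContinuous_of_weak_limit hpos hsq U hp
  refine ⟨p, q, inferInstance, inferInstance, hac, fun f hf => ?_⟩
  have hreal (g : Circle → ℝ) (hg : Continuous g) :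
      Tendsto (fun k => ∫ ζ, g ζ * u k ζ ∂haar) U (𝓝 (∫ ζ, g ζ ∂p - ∫ ζ, g ζ ∂q)) := by
    refine ((hp g hg).sub (hq g hg)).congr fun k => ?_
    rw [← integral_sub (f := fun ζ => g ζ * max (u k ζ) 0) (g := fun ζ => g ζ * max (-u k ζ) 0)
      (integrable_of_continuous _ (hg.mul (hpos k)))
      (integrable_of_continuous _ (hg.mul (hneg k)))]
    refine integral_congr_ae (.of_forall fun ζ => ?_)
    simp only
    rw [← mul_sub, ← hsplit]
  have hre := (Complex.continuous_ofReal.tendsto _).comp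
    (hreal (fun ζ => (f ζ).re) (Complex.continuous_re.comp hf))
  have him := (Complex.continuous_ofReal.tendsto _).comp
    (hreal (fun ζ => (f ζ).im) (Complex.continuous_im.comp hf))
  have hlim := hre.add (him.mul_const Complex.I)
  have hval (ρ : Measure Circle) [IsFiniteMeasure ρ] : ∫ ζ, f ζ ∂ρ =
      ((∫ ζ, (f ζ).re ∂ρ : ℝ) : ℂ) + ((∫ ζ, (f ζ).im ∂ρ : ℝ) : ℂ) * Complex.I := by
    have := integral_ofReal_mul_complex (ρ := ρ) hf (continuous_const (y := (1 : ℝ)))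
    simpa using this
  have heq : ∫ ζ, f ζ ∂p - ∫ ζ, f ζ ∂q =
      ((∫ ζ, (f ζ).re ∂p - ∫ ζ, (f ζ).re ∂q : ℝ) : ℂ) +
      ((∫ ζ, (f ζ).im ∂p - ∫ ζ, (f ζ).im ∂q : ℝ) : ℂ) * Complex.I := by
    rw [hval p, hval q]
    push_cast
    ring
  rw [heq]
  refine hlim.congr fun k => ?_
  exact (integral_ofReal_mul_complex hf (hu k)).symm

/-! ### Invariant measures -/

/-- If the difference of an absolutely continuous measure `p` and a measure `q` is invariant under
`ζ ↦ ζ ^ N`, then up to a multiple of Haar measure it is minus the singular part of `q`. -/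
lemma integral_zpow_singularPart_of_invariant {N : ℕ} (hN : 2 ≤ N) {p q : Measure Circle}
    [IsFiniteMeasure p] [IsFiniteMeasure q] (hp : p ≪ haar)
    (hinv : ∀ n : ℤ, ∫ ζ : Circle, (ζ : ℂ) ^ (n * N) ∂p - ∫ ζ : Circle, (ζ : ℂ) ^ (n * N) ∂q =
      ∫ ζ : Circle, (ζ : ℂ) ^ n ∂p - ∫ ζ : Circle, (ζ : ℂ) ^ n ∂q) {n : ℤ} (hn : n ≠ 0) :
    ∫ ζ : Circle, (ζ : ℂ) ^ n ∂p - ∫ ζ : Circle, (ζ : ℂ) ^ n ∂q =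
      -∫ ζ : Circle, (ζ : ℂ) ^ n ∂(q.singularPart haar) := by
  have hN0 : N ≠ 0 := by omega
  set T : Circle → Circle := fun ζ => ζ ^ N with hT_def
  have hT : Measurable T := by fun_prop
  set s := q.singularPart haar with hs_def
  set g := haar.withDensity (q.rnDeriv haar) with hg_def
  have hq : q = s + g := q.haveLebesgueDecomposition_add haar
  have hg : g ≪ haar := withDensity_absolutelyContinuous _ _
  have : IsFiniteMeasure g := isFiniteMeasure_of_le q (by rw [hq]; exact Measure.le_add_left le_rfl)
  have hmap_ac {ρ : Measure Circle} (h : ρ ≪ haar) : ρ.map T ≪ haar := by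
    have h' := h.map hT
    rwa [hT_def, haar_map_pow hN0] at h'
  have hint (ρ : Measure Circle) [IsFiniteMeasure ρ] (m : ℤ) :
      Integrable (fun ζ : Circle => (ζ : ℂ) ^ m) ρ :=
    integrable_of_continuous _ (continuous_coe_zpow m)
  have hTfin (ρ : Measure Circle) [IsFiniteMeasure ρ] : IsFiniteMeasure (ρ.map T) :=
    Measure.isFiniteMeasure_map _ _
  have hmeas : p.map T + q = p + q.map T := by
    refine measure_ext_of_integral_zpow fun m => ?_
    rw [integral_add_measure (hint _ _) (hint _ _), integral_add_measure (hint _ _) (hint _ _),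
      integral_zpow_map_pow, integral_zpow_map_pow]
    linear_combination hinv m
  -- Compare singular parts in `hmeas`: the left side has s, and the right side has that of the
  -- image of q, which is the image of s.
  have hsT : s.map T = s := by
    have h := congrArg (fun ρ : Measure Circle => ρ.singularPart haar) hmeas
    simp only [Measure.singularPart_add] at h
    rw [Measure.singularPart_eq_zero_of_ac (hmap_ac hp), Measure.singularPart_eq_zero_of_ac hp,
      zero_add, zero_add] at h
    rw [hs_def, h]
    conv_rhs => rw [hq, Measure.map_add _ _ hT, Measure.singularPart_add,
      Measure.singularPart_eq_zero_of_ac (hmap_ac hg), add_zero,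
      Measure.singularPart_eq_self.2
        (mutuallySingular_map_pow hN0 (q.mutuallySingular_singularPart haar))]
    rw [← h]
  -- Coefficients of the absolutely continuous part p - g of p - q.
  set a : ℤ → ℂ := fun m => ∫ ζ : Circle, (ζ : ℂ) ^ m ∂p - ∫ ζ : Circle, (ζ : ℂ) ^ m ∂g with ha
  have had (m : ℤ) : ∫ ζ : Circle, (ζ : ℂ) ^ m ∂p - ∫ ζ : Circle, (ζ : ℂ) ^ m ∂q =
      a m - ∫ ζ : Circle, (ζ : ℂ) ^ m ∂s := by
    have : ∫ ζ : Circle, (ζ : ℂ) ^ m ∂q =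
        ∫ ζ : Circle, (ζ : ℂ) ^ m ∂s + ∫ ζ : Circle, (ζ : ℂ) ^ m ∂g := by
      rw [← integral_add_measure (hint _ _) (hint _ _), ← hq]
    rw [this, ha]
    ring
  have haN (m : ℤ) : a (m * N) = a m := by
    have h1 := hinv m
    rw [had, had, ← integral_zpow_map_pow] at h1
    rw [← hT_def, hsT] at h1
    simpa using h1
  have haNk (k : ℕ) : a (n * N ^ k) = a n := by
    induction k with
    | zero => simp
    | succ k ih => rw [pow_succ, ← mul_assoc, haN, ih]
  have hinj : Function.Injective fun k : ℕ => n * (N : ℤ) ^ k := by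
    intro i j hij
    have h1 : (N : ℤ) ^ i = (N : ℤ) ^ j := mul_left_cancel₀ hn hij
    exact Nat.pow_right_injective hN (by exact_mod_cast h1)
  -- As n ≠ 0 and N ≥ 2, the indices n N^k leave every finite set, so Riemann–Lebesgue applies to p
  -- and g.
  have hcoc : Tendsto (fun k : ℕ => n * (N : ℤ) ^ k) atTop (cocompact ℤ) := by
    rw [cocompact_eq_cofinite, ← Nat.cofinite_eq_atTop]
    exact hinj.tendsto_cofinite
  have hlim : Tendsto (fun k : ℕ => a (n * (N : ℤ) ^ k)) atTop (𝓝 (0 - 0)) :=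
    (tendsto_integral_zpow_of_absolutelyContinuous hp hcoc).sub
      (tendsto_integral_zpow_of_absolutelyContinuous hg hcoc)
  simp_rw [haNk] at hlim
  rw [had, tendsto_nhds_unique tendsto_const_nhds hlim]
  ring

/-! ### The characterization -/

/-- The coefficients of the power series `∑_{ν ≥ 1} c_ν z ^ ν`, including the constant one. -/
def positiveCoeff (c : ℤ → ℂ) (n : ℕ) : ℂ := if n = 0 then 0 else c n

lemma hasSum_positiveCoeff {c : ℤ → ℂ} {C : ℝ} (hc : ∀ ν, ‖c ν‖ ≤ C) (z : ℂ) (hz : ‖z‖ < 1) :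
    HasSum (fun n : ℕ => positiveCoeff c n * z ^ n) (positivePart c z) := by
  rw [← hasSum_nat_add_iff' 1]
  simpa [positiveCoeff] using hasSum_positivePart hc hz

lemma continuous_positivePart_circle {c : ℤ → ℂ} {C : ℝ} (hc : ∀ ν, ‖c ν‖ ≤ C) {r : ℝ}
    (hr0 : 0 ≤ r) (hr : r < 1) : Continuous fun ζ : Circle => positivePart c (r * ζ) := by
  simp_rw [eq_tsum_on_circle (hasSum_positiveCoeff hc) hr0 hr]
  exact continuous_tsum_mul_pow (summable_norm_mul_pow (hasSum_positiveCoeff hc) hr0 hr)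

/-- The nonnegative Fourier coefficients of the real part of `∑_{ν ≥ 1} c_ν z ^ ν` on a circle. -/
lemma integral_re_positivePart {c : ℤ → ℂ} {C : ℝ} (hc : ∀ ν, ‖c ν‖ ≤ C) {r : ℝ}
    (hr0 : 0 ≤ r) (hr : r < 1) (n : ℕ) :
    ∫ ζ : Circle, (ζ : ℂ) ^ (-(n : ℤ)) * ((positivePart c (r * ζ)).re : ℂ) ∂haar =
      positiveCoeff c n * r ^ n / 2 := by
  have hcont := continuous_positivePart_circle hc hr0 hr
  have hcoeff (k : ℤ) : ∫ ζ : Circle, positivePart c (r * ζ) * (ζ : ℂ) ^ (-k) ∂haar =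
      if 0 ≤ k then positiveCoeff c k.toNat * (r : ℂ) ^ k.toNat else 0 := by
    simp_rw [eq_tsum_on_circle (hasSum_positiveCoeff hc) hr0 hr]
    exact integral_tsum_mul_zpow (summable_norm_mul_pow (hasSum_positiveCoeff hc) hr0 hr) k
  have hsplit (ζ : Circle) : (ζ : ℂ) ^ (-(n : ℤ)) * ((positivePart c (r * ζ)).re : ℂ) =
      positivePart c (r * ζ) * (ζ : ℂ) ^ (-(n : ℤ)) / 2 +
        conj (positivePart c (r * ζ) * (ζ : ℂ) ^ (-(-(n : ℤ)))) / 2 := by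
    rw [Complex.re_eq_add_conj, map_mul, conj_coe_zpow, neg_neg]
    ring
  have hint (k : ℤ) : Continuous fun ζ : Circle => positivePart c (r * ζ) * (ζ : ℂ) ^ (-k) :=
    hcont.mul (continuous_coe_zpow _)
  -- The conjugate half of the real part has only nonpositive frequencies; at n = 0 it vanishes
  -- because the series has no constant term.
  have hconj : conj (∫ ζ : Circle, positivePart c (r * ζ) * (ζ : ℂ) ^ (-(-(n : ℤ))) ∂haar) = 0 := by
    rw [hcoeff]
    rcases Nat.eq_zero_or_pos n with rfl | hn
    · simp [positiveCoeff]
    · rw [if_neg (by omega), map_zero]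
  simp_rw [hsplit]
  rw [integral_add (f := fun ζ : Circle => positivePart c (r * ζ) * (ζ : ℂ) ^ (-(n : ℤ)) / 2)
    (g := fun ζ : Circle => conj (positivePart c (r * ζ) * (ζ : ℂ) ^ (-(-(n : ℤ)))) / 2)
    (integrable_of_continuous _ ((hint _).div_const _))
    (integrable_of_continuous _ ((Complex.continuous_conj.comp (hint _)).div_const _)),
    integral_div, integral_div, integral_conj, hconj, hcoeff]
  simp

/-- Sufficiency of the second form of the summability condition. -/
lemma exists_special_of_hasSquareSummableCoeffs {N : ℕ} (hN : 2 ≤ N) {c : ℤ → ℂ} {C : ℝ}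
    (hc : ∀ ν, ‖c ν‖ ≤ C) (hconj : ∀ ν, c (-ν) = conj (c ν)) (hcN : ∀ ν : ℤ, c (ν * N) = c ν)
    {ε : ℝ} (hε : 0 < ε)
    (h : HasSquareSummableCoeffs fun z => Complex.exp (-(ε : ℂ) * positivePart c z)) :
    ∃ μ : SignedMeasure Circle, IsPowInvariant N μ ∧ IsSpecial μ ∧
      ∀ ν : ℤ, fourierCoefficient μ ν = c ν := by
  obtain ⟨b, hb, hbsum⟩ := h
  set r : ℕ → ℝ := fun k => 1 - 1 / ((k : ℝ) + 1) with hr_def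
  have hr0 (k : ℕ) : 0 ≤ r k := by
    have : 1 / ((k : ℝ) + 1) ≤ 1 := by
      rw [div_le_one (by positivity)]
      linarith [Nat.cast_nonneg (α := ℝ) k]
    simp only [hr_def]
    linarith
  have hr1 (k : ℕ) : r k < 1 := by
    have : 0 < 1 / ((k : ℝ) + 1) := by positivity
    simp only [hr_def]
    linarith
  have hrlim : Tendsto r atTop (𝓝 1) := by
    simpa [hr_def] using (tendsto_const_nhds (x := (1 : ℝ))).sub
      (tendsto_one_div_add_atTop_nhds_zero_nat (𝕜 := ℝ))
  -- Chosen so that e^{u_k} is the modulus of exp(-ε f) on the circle of radius r_k.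
  set u : ℕ → Circle → ℝ := fun k ζ => -ε * (positivePart c (r k * ζ)).re with hu_def
  have hu (k : ℕ) : Continuous (u k) :=
    continuous_const.mul (Complex.continuous_re.comp
      (continuous_positivePart_circle hc (hr0 k) (hr1 k)))
  have hucoeff (k n : ℕ) : ∫ ζ : Circle, (ζ : ℂ) ^ (-(n : ℤ)) * (u k ζ : ℂ) ∂haar =
      -ε / 2 * positiveCoeff c n * r k ^ n := by
    have h1 (ζ : Circle) : (ζ : ℂ) ^ (-(n : ℤ)) * (u k ζ : ℂ) =
        -ε * ((ζ : ℂ) ^ (-(n : ℤ)) * ((positivePart c (r k * ζ)).re : ℂ)) := by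
      simp only [hu_def]
      push_cast
      ring
    simp_rw [h1]
    rw [integral_const_mul, integral_re_positivePart hc (hr0 k) (hr1 k)]
    ring
  have hu0 (k : ℕ) : ∫ ζ, u k ζ ∂haar = 0 := by
    have h1 := hucoeff k 0
    simp only [Nat.cast_zero, neg_zero, zpow_zero, one_mul, positiveCoeff, if_true, mul_zero,
      zero_mul] at h1
    have h2 : ∫ ζ, (u k ζ : ℂ) ∂haar = ((∫ ζ, u k ζ ∂haar : ℝ) : ℂ) := integral_ofReal
    rw [h2] at h1
    exact_mod_cast h1
  have hB (k : ℕ) : ∫ ζ, Real.exp (u k ζ) ^ 2 ∂haar ≤ ∑' n, ‖b n‖ ^ 2 := by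
    have h1 := hasSum_sq_norm_coeff hb (hr0 k) (hr1 k)
    have h2 (ζ : Circle) : Real.exp (u k ζ) = ‖Complex.exp (-ε * positivePart c (r k * ζ))‖ := by
      rw [Complex.norm_exp]
      simp [hu_def]
    simp_rw [h2]
    refine hasSum_le (fun n => ?_) h1 hbsum.hasSum
    refine mul_le_of_le_one_right (by positivity) ?_
    exact pow_le_one₀ (pow_nonneg (hr0 k) n) (pow_le_one₀ (hr0 k) (hr1 k).le)
  obtain ⟨p, q, _, _, hp, hlim⟩ :=
    exists_weak_limit_of_integral_exp_le hu hB hu0 (hyperfilter ℕ)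
  have hd (n : ℕ) : ∫ ζ : Circle, (ζ : ℂ) ^ (-(n : ℤ)) ∂p - ∫ ζ : Circle, (ζ : ℂ) ^ (-(n : ℤ)) ∂q =
      -ε / 2 * positiveCoeff c n := by
    have h1 := hlim _ (continuous_coe_zpow (-(n : ℤ)))
    simp_rw [hucoeff] at h1
    have h2 : Tendsto (fun k => -ε / 2 * positiveCoeff c n * (r k : ℂ) ^ n) (hyperfilter ℕ)
        (𝓝 (-ε / 2 * positiveCoeff c n * ((1 : ℝ) : ℂ) ^ n)) :=
      ((((Complex.continuous_ofReal.tendsto 1).comp hrlim).pow n).const_mul _).mono_left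
        Nat.hyperfilter_le_atTop
    rw [tendsto_nhds_unique h1 h2]
    simp
  -- Negative indices follow by conjugation, using (i).
  have hdz (ν : ℤ) : ∫ ζ : Circle, (ζ : ℂ) ^ (-ν) ∂p - ∫ ζ : Circle, (ζ : ℂ) ^ (-ν) ∂q =
      if ν = 0 then 0 else -ε / 2 * c ν := by
    obtain ⟨n, rfl | rfl⟩ := ν.eq_nat_or_neg
    · rw [hd, positiveCoeff]
      simp
    · rw [integral_zpow_neg p, integral_zpow_neg q, ← map_sub, hd, positiveCoeff, hconj]
      simp only [neg_eq_zero, Nat.cast_eq_zero]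
      split_ifs <;> simp [map_ofNat]
  set s := q.singularPart haar with hs
  have hN0 : N ≠ 0 := by omega
  have hsing (ν : ℤ) (hν : ν ≠ 0) : ∫ ζ : Circle, (ζ : ℂ) ^ (-ν) ∂s = ε / 2 * c ν := by
    have h1 := integral_zpow_singularPart_of_invariant hN hp (n := -ν) (q := q) (fun n => by
      obtain ⟨m, rfl⟩ : ∃ m, n = -m := ⟨-n, by simp⟩
      rw [neg_mul, hdz, hdz, hcN]
      simp [hN0]) (neg_ne_zero.2 hν)
    rw [hdz, if_neg hν, ← hs] at h1
    linear_combination h1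
  have hc0 : ((c 0).re : ℂ) = c 0 := Complex.conj_eq_iff_re.1 (by rw [← hconj, neg_zero])
  have hε' : (ε : ℂ) ≠ 0 := by exact_mod_cast hε.ne'
  -- The factor 2/ε undoes the ε/2 in `hsing`.
  set σ : Measure Circle := (2 / ε).toNNReal • s with hσ
  have hσint (n : ℤ) : ∫ ζ : Circle, (ζ : ℂ) ^ n ∂σ = 2 / ε * ∫ ζ : Circle, (ζ : ℂ) ^ n ∂s := by
    rw [hσ, integral_smul_nnreal_measure, NNReal.smul_def, Real.coe_toNNReal _ (by positivity),
      Complex.real_smul]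
    push_cast
    rfl
  -- Haar measure affects only the zeroth coefficient, so a is what corrects it to c_0, which is
  -- real by (i).
  set a : ℝ := (c 0).re - 2 / ε * s.real Set.univ with ha
  have hcoeff (ν : ℤ) :
      fourierCoefficient (a • haar.toSignedMeasure + σ.toSignedMeasure) ν = c ν := by
    rw [fourierCoefficient_special, hσint]
    split_ifs with hν
    · subst hν
      simp only [neg_zero, zpow_zero, integral_const, Complex.real_smul, mul_one]
      rw [← hc0, ha]
      push_cast
      ring
    · rw [hsing ν hν]
      field_simp
      ring
  refine ⟨a • haar.toSignedMeasure + σ.toSignedMeasure, ?_, ⟨a, σ, inferInstance, ?_, rfl⟩, hcoeff⟩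
  · rw [isPowInvariant_iff]
    intro ν
    rw [hcoeff, hcoeff, hcN]
  · exact (q.mutuallySingular_singularPart haar).smul _

/-- Necessity of the first form of the summability condition. -/
lemma hasSquareSummableCoeffs_of_special {μ : SignedMeasure Circle} (hμ : IsSpecial μ)
    {c : ℤ → ℂ} {C : ℝ} (hc : ∀ ν, ‖c ν‖ ≤ C) (hμc : ∀ ν, fourierCoefficient μ ν = c ν) :
    HasSquareSummableCoeffs fun z => Complex.exp (-c 0 - 2 * positivePart c z) := by
  obtain ⟨a, σ, _, -, rfl⟩ := hμ
  simp_rw [fourierCoefficient_special] at hμc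
  -- Here c_0 + 2f is a plus the Herglotz transform of σ, so its real part is at least a.
  refine hasSquareSummableCoeffs_of_bounded (M := Real.exp (-a)) ?_ fun z hz => ?_
  · have := differentiableOn_positivePart hc
    fun_prop
  · have h := re_herglotz_nonneg σ hz
    have hpos : positivePart (fun ν => ∫ ζ : Circle, (ζ : ℂ) ^ (-ν) ∂σ) z = positivePart c z := by
      refine tsum_congr fun n => ?_
      rw [← hμc, if_neg (by omega), zero_add]
    rw [hpos] at h
    rw [Complex.norm_exp, Real.exp_le_exp, ← hμc 0, if_pos rfl]
    simp only [Complex.add_re, Complex.sub_re, Complex.neg_re, Complex.ofReal_re] at h ⊢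
    linarith

lemma conj_fourierCoefficient_of_special {μ : SignedMeasure Circle} (hμ : IsSpecial μ) (ν : ℤ) :
    fourierCoefficient μ (-ν) = conj (fourierCoefficient μ ν) := by
  obtain ⟨a, σ, _, -, rfl⟩ := hμ
  rw [fourierCoefficient_special, fourierCoefficient_special, integral_zpow_neg σ (-ν), map_add]
  simp only [neg_eq_zero]
  split_ifs <;> simp

lemma HasSquareSummableCoeffs.const_mul {F : ℂ → ℂ} (h : HasSquareSummableCoeffs F) (a : ℂ) :
    HasSquareSummableCoeffs fun z => a * F z := by
  obtain ⟨b, hb, hsum⟩ := h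
  refine ⟨fun n => a * b n, fun z hz => ?_, ?_⟩
  · simpa only [mul_assoc] using (hb z hz).mul_left a
  · simpa only [norm_mul, mul_pow] using hsum.mul_left (‖a‖ ^ 2)

/-- The first form of the summability condition implies the second one, with `ε = 2`. -/
lemma exists_hasSquareSummableCoeffs {c : ℤ → ℂ}
    (h : HasSquareSummableCoeffs fun z => Complex.exp (-c 0 - 2 * positivePart c z)) :
    ∃ ε : ℝ, 0 < ε ∧
      HasSquareSummableCoeffs fun z => Complex.exp (-(ε : ℂ) * positivePart c z) := by
  refine ⟨2, two_pos, ?_⟩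
  convert h.const_mul (Complex.exp (c 0)) using 2 with z
  rw [← Complex.exp_add]
  congr 1
  push_cast
  ring

end CircleMeasure

end

theorem corollary9 (N : ℕ) (hN : 2 ≤ N) (c : ℤ → ℂ) (hc : ∃ C : ℝ, ∀ ν : ℤ, ‖c ν‖ ≤ C) :
    -- the characterization with the first form of the summability condition
    ((∃ μ : SignedMeasure Circle, CircleMeasure.IsPowInvariant N μ ∧ CircleMeasure.IsSpecial μ ∧
        ∀ ν : ℤ, CircleMeasure.fourierCoefficient μ ν = c ν) ↔
      (∀ ν : ℤ, c (-ν) = starRingEnd ℂ (c ν)) ∧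
      (∀ ν : ℤ, c (ν * N) = c ν) ∧
      CircleMeasure.HasSquareSummableCoeffs
        (fun z => Complex.exp (-c 0 - 2 * CircleMeasure.positivePart c z))) ∧
    -- the characterization with the second form
    ((∃ μ : SignedMeasure Circle, CircleMeasure.IsPowInvariant N μ ∧ CircleMeasure.IsSpecial μ ∧
        ∀ ν : ℤ, CircleMeasure.fourierCoefficient μ ν = c ν) ↔
      (∀ ν : ℤ, c (-ν) = starRingEnd ℂ (c ν)) ∧
      (∀ ν : ℤ, c (ν * N) = c ν) ∧
      ∃ ε : ℝ, 0 < ε ∧ CircleMeasure.HasSquareSummableCoeffs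
        (fun z => Complex.exp (-(ε : ℂ) * CircleMeasure.positivePart c z))) ∧
    -- the second form is weaker than the first
    (CircleMeasure.HasSquareSummableCoeffs
        (fun z => Complex.exp (-c 0 - 2 * CircleMeasure.positivePart c z)) →
      ∃ ε : ℝ, 0 < ε ∧ CircleMeasure.HasSquareSummableCoeffs
        (fun z => Complex.exp (-(ε : ℂ) * CircleMeasure.positivePart c z))) ∧
    -- the measure is uniquely determined
    (∀ μ₁ μ₂ : SignedMeasure Circle,
      CircleMeasure.IsPowInvariant N μ₁ → CircleMeasure.IsSpecial μ₁ →
      (∀ ν : ℤ, CircleMeasure.fourierCoefficient μ₁ ν = c ν) →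
      CircleMeasure.IsPowInvariant N μ₂ → CircleMeasure.IsSpecial μ₂ →
      (∀ ν : ℤ, CircleMeasure.fourierCoefficient μ₂ ν = c ν) → μ₁ = μ₂) := by
  obtain ⟨C, hC⟩ := hc
  have hnec : (∃ μ : SignedMeasure Circle, CircleMeasure.IsPowInvariant N μ ∧
      CircleMeasure.IsSpecial μ ∧ ∀ ν : ℤ, CircleMeasure.fourierCoefficient μ ν = c ν) →
      (∀ ν : ℤ, c (-ν) = starRingEnd ℂ (c ν)) ∧ (∀ ν : ℤ, c (ν * N) = c ν) ∧
      CircleMeasure.HasSquareSummableCoeffs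
        (fun z => Complex.exp (-c 0 - 2 * CircleMeasure.positivePart c z)) := by
    rintro ⟨μ, hinv, hspec, hμ⟩
    refine ⟨fun ν => ?_, fun ν => ?_,
      CircleMeasure.hasSquareSummableCoeffs_of_special hspec hC hμ⟩
    · rw [← hμ, ← hμ, CircleMeasure.conj_fourierCoefficient_of_special hspec]
    · rw [← hμ, ← hμ, (CircleMeasure.isPowInvariant_iff N μ).1 hinv]
  have hweak := CircleMeasure.exists_hasSquareSummableCoeffs (c := c)
  -- Both equivalences come from one cycle: the measure gives (iii), which gives (iii'), which with
  -- (i) and (ii) gives the measure back.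
  refine ⟨⟨hnec, ?_⟩, ⟨fun h => ?_, ?_⟩, hweak, ?_⟩
  · rintro ⟨hconj, hcN, h⟩
    obtain ⟨ε, hε, hsum⟩ := hweak h
    exact CircleMeasure.exists_special_of_hasSquareSummableCoeffs hN hC hconj hcN hε hsum
  · obtain ⟨hconj, hcN, hsum⟩ := hnec h
    exact ⟨hconj, hcN, hweak hsum⟩
  · rintro ⟨hconj, hcN, ε, hε, hsum⟩
    exact CircleMeasure.exists_special_of_hasSquareSummableCoeffs hN hC hconj hcN hε hsum
  · intro μ₁ μ₂ _ _ h₁ _ _ h₂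
    exact CircleMeasure.signedMeasure_ext_of_fourierCoefficient fun ν => (h₁ ν).trans (h₂ ν).symm
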